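/- Let $\alpha=[0;a_1,a_2,\dots]\in[0,1)$ be irrational, with partial quotients $(a_n)_{n\ge1}$ and denominators $q_0=1$, $q_1=a_1$, $q_{n+2}=a_{n+2}q_{n+1}+q_n$ of its convergents. For a $1$-periodic function $\varphi$ let $V(\varphi)$ be the variation of its restriction to $[0,1)$, call $\varphi$ centered BV if $V(\varphi)<\infty$ and $\int_0^1\varphi\,d\mu=0$ ($\mu$ Lebesgue measure), and put $\varphi_N(x)=\sum_{j=0}^{N-1}\varphi(x+j\alpha)$. Let $A\ge1$ and $p\ge0$. There are constants $C,\theta_1,\theta_2,\theta_3\in\mathbb R$, depending only on $A$ and $p$, such that, if $a_n\le A\,n^p$ for all $n\ge1$, then for all (real- or complex-valued) centered BV functions $\psi,\varphi$, all sequences $(b_k)$ of non-negative integers and all integers $1\le n\le m\le\ell$, $$\Big|\int_0^1\psi\,\varphi_{b_nq_n}\,d\mu\Big|\le C\,V(\psi)\,V(\varphi)\,\frac{n^{\theta_1}}{q_n}\,b_n,$$ $$\Big|\int_0^1\psi\,\varphi_{b_nq_n}\,\varphi_{b_mq_m}\,d\mu\Big|\le C\,V(\psi)\,V(\varphi)^2\,\frac{m^{\theta_2}}{q_n}\,b_nb_m,$$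 $$\Big|\int_0^1\psi\,\varphi_{b_nq_n}\,\varphi_{b_mq_m}\,\varphi_{b_\ell q_\ell}\,d\mu\Big|\le C\,V(\psi)\,V(\varphi)^3\,\frac{\ell^{\theta_3}}{q_n}\,b_nb_mb_\ell.$$ -/

import Mathlib

open MeasureTheory Set

noncomputable section

namespace CircleRotation

/-- The partial quotient `a_n` (`n ≥ 1`) of the regular continued fraction `[a_0; a_1, a_2, …]`
of `α`, as a natural number. The value at `n = 0` is a placeholder that is never used. -/
def partialQuotient (α : ℝ) : ℕ → ℕ
  | 0 => 0
  | n + 1 => ⌊((GenContFract.of α).partDens.get? n).getD 0⌋₊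

/-- The denominators `q_0 = 1`, `q_1 = a_1`, `q_{n+2} = a_{n+2} q_{n+1} + q_n` of the convergents
of `α`. -/
def denominator (α : ℝ) : ℕ → ℕ
  | 0 => 1
  | 1 => partialQuotient α 1
  | n + 2 => partialQuotient α (n + 2) * denominator α (n + 1) + denominator α n

/-- The continued fraction of an irrational number does not terminate, and its partial quotients
are the natural numbers `partialQuotient α (n + 1)`. -/
theorem get?_partDens_of_irrational {α : ℝ} (hα : Irrational α) (n : ℕ) :
    (GenContFract.of α).partDens.get? n = some (partialQuotient α (n + 1) : ℝ) := by
  have hnt : ¬ (GenContFract.of α).TerminatedAt n := by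
    intro h
    obtain ⟨q, hq⟩ := (GenContFract.terminates_iff_rat α).1 ⟨n, h⟩
    exact hα ⟨q, hq.symm⟩
  obtain ⟨b, hb⟩ : ∃ b, (GenContFract.of α).partDens.get? n = some b := by
    rw [← Option.ne_none_iff_exists']
    intro h
    exact hnt (GenContFract.terminatedAt_iff_partDen_none.2 h)
  obtain ⟨z, rfl⟩ := GenContFract.exists_int_eq_of_partDen hb
  have h1 : (1 : ℝ) ≤ z := GenContFract.of_one_le_get?_partDen hb
  lift z to ℕ using by
    have : (1 : ℤ) ≤ z := by exact_mod_cast h1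
    omega
  simp [partialQuotient, hb]

/-- The coefficients of the continued fraction of an irrational number. -/
theorem get?_s_of_irrational {α : ℝ} (hα : Irrational α) (n : ℕ) :
    (GenContFract.of α).s.get? n = some ⟨1, (partialQuotient α (n + 1) : ℝ)⟩ := by
  obtain ⟨gp, hgp, hb⟩ :=
    GenContFract.exists_s_b_of_partDen (get?_partDens_of_irrational hα n)
  have ha := (GenContFract.of_partNum_eq_one_and_exists_int_partDen_eq hgp).1
  rw [hgp]
  cases gp
  simp_all

/-- `denominator α n` is the denominator of the `n`-th convergent of `α`. -/
theorem dens_of_irrational {α : ℝ} (hα : Irrational α) (n : ℕ) :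
    (GenContFract.of α).dens n = (denominator α n : ℝ) := by
  induction n using Nat.twoStepInduction with
  | zero => simp [denominator]
  | one => simpa [denominator] using GenContFract.first_den_eq (get?_s_of_irrational hα 0)
  | more n ih0 ih1 =>
    rw [GenContFract.dens_recurrence (get?_s_of_irrational hα (n + 1)) ih0 ih1]
    simp [denominator]

/-- The variation `V(φ)` of `φ` on `[0, 1)`. -/
def variation (φ : ℝ → ℂ) : ℝ := (eVariationOn φ (Ico 0 1)).toReal

/-- The class of `1`-periodic functions that have bounded variation on `[0, 1)` and integral `0`
over a period. -/
structure IsCenteredBV (φ : ℝ → ℂ) : Prop where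
  periodic : Function.Periodic φ 1
  boundedVariation : BoundedVariationOn φ (Ico 0 1)
  centered : ∫ x in Ico (0 : ℝ) 1, φ x = 0

/-- The ergodic sum `φ_N(x) = ∑_{j=0}^{N-1} φ(x + j α)`. -/
def ergodicSum (α : ℝ) (φ : ℝ → ℂ) (N : ℕ) (x : ℝ) : ℂ :=
  ∑ j ∈ Finset.range N, φ (x + j * α)

end CircleRotation

end

/-! Write `ψ = u - u ∘ T + ψ_N / N`, where `T` is the rotation by `α`, `N = q_n` and `u` is the mean
of the ergodic sums `ψ_k`, `k < N`. For `F` a product of sums `φ_{b_k q_k}`, invariance of the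
integral gives `∫ ψ F = ∫ (u ∘ T) (F ∘ T - F) + (1/N) ∫ ψ_N F`.

Three facts bound the right side. By Denjoy–Koksma, `|ψ_{q_n}| ≤ 2 V(ψ)` and `|φ_{b q_k}| ≤ 2 b
V(φ)`. Cutting `k < q_n` into blocks of lengths `q_i` gives `|u| ≤ 2 V(ψ) (a_1 + ... + a_n)`,
polynomial in `n`. Finally `φ_{b q_k} ∘ T - φ_{b q_k}` telescopes to an increment of `φ` over a step
`b (q_k α - p_k)`, of `L¹` norm at most `2 V(φ) b / q_k`. Up to three factors with indices at least
`n` are then combined by the Leibniz rule, and every term is `O(1/q_n)` times a polynomial. -/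

noncomputable section

namespace CircleRotation

/-! ### Variation on the circle through monotone lifts -/

/-- `v` is a lift of a measure of mass `W` on the circle which dominates the increments of `φ`. -/
structure Dominates (v : ℝ → ℝ) (W : ℝ) (φ : ℝ → ℂ) : Prop where
  add_one : ∀ x, v (x + 1) = v x + W
  norm_sub_le : ∀ x y, x ≤ y → ‖φ y - φ x‖ ≤ v y - v x

theorem variation_nonneg (φ : ℝ → ℂ) : 0 ≤ variation φ := ENNReal.toReal_nonneg

/-- The lift accumulates the variation within a period and gains `2 V` per turn: one `V` covers the
restart of the accumulated variation, the other pays for the increment of `φ` across an integer. -/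
theorem exists_dominates {φ : ℝ → ℂ} (hp : Function.Periodic φ 1)
    (hb : BoundedVariationOn φ (Ico 0 1)) : ∃ v, Dominates v (2 * variation φ) φ := by
  have hl := hb.locallyBoundedVariationOn
  have hfr : ∀ x, φ (Int.fract x) = φ x := fun x => by
    have := hp.sub_int_mul_eq (x := x) ⌊x⌋
    rwa [mul_one] at this
  have hmem : ∀ x : ℝ, Int.fract x ∈ Ico (0 : ℝ) 1 :=
    fun x => ⟨Int.fract_nonneg x, Int.fract_lt_one x⟩
  have h0 : (0 : ℝ) ∈ Ico (0 : ℝ) 1 := by simp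
  set w := variationOnFromTo φ (Ico 0 1) 0 with hw
  refine ⟨fun x => w (Int.fract x) + 2 * variation φ * ⌊x⌋, ?_, ?_⟩
  · intro x
    simp only [Int.fract_add_one, Int.floor_add_one]
    push_cast
    ring
  · intro x y hxy
    rw [← hfr x, ← hfr y]
    rcases (Int.floor_mono hxy).eq_or_lt with h | h
    · have hle : Int.fract x ≤ Int.fract y := by
        simp only [Int.fract, h]
        linarith
      have hsub := variationOnFromTo.sub_right hl h0 (hmem y) (hmem x)
      rw [← hw, variationOnFromTo.eq_of_le _ _ hle] at hsub
      have hfin : BoundedVariationOn φ (Ico 0 1 ∩ Icc (Int.fract x) (Int.fract y)) :=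
        hb.mono inter_subset_left
      have := hfin.dist_le (x := Int.fract y) (y := Int.fract x)
        ⟨hmem y, hle, le_rfl⟩ ⟨hmem x, le_rfl, hle⟩
      rw [dist_eq_norm] at this
      simp only [h]
      linarith
    · have h1 := hb.dist_le (hmem y) (hmem x)
      rw [dist_eq_norm] at h1
      change _ ≤ variation φ at h1
      have h2 : w (Int.fract x) ≤ variation φ :=
        (le_abs_self _).trans (variationOnFromTo.abs_le_eVariationOn hb)
      have h3 : 0 ≤ w (Int.fract y) := variationOnFromTo.nonneg_of_le _ _ (Int.fract_nonneg y)
      have h4 : (⌊x⌋ : ℝ) + 1 ≤ ⌊y⌋ := by exact_mod_cast h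
      have h5 := mul_le_mul_of_nonneg_left h4 (variation_nonneg φ)
      linarith

namespace Dominates

variable {v : ℝ → ℝ} {W : ℝ} {φ : ℝ → ℂ}

theorem monotone (h : Dominates v W φ) : Monotone v := fun x y hxy =>
  sub_nonneg.1 ((norm_nonneg _).trans (h.norm_sub_le x y hxy))

/-- Real and imaginary parts become differences of monotone functions, which yields measurability.
-/
theorem monotone_re_add (h : Dominates v W φ) : Monotone fun x => (φ x).re + v x :=
  fun x y hxy => by
    have h1 := (Complex.abs_re_le_norm _).trans (h.norm_sub_le x y hxy)
    rw [Complex.sub_re] at h1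
    have h2 := (abs_le.1 h1).1
    simp only
    linarith

theorem monotone_im_add (h : Dominates v W φ) : Monotone fun x => (φ x).im + v x :=
  fun x y hxy => by
    have h1 := (Complex.abs_im_le_norm _).trans (h.norm_sub_le x y hxy)
    rw [Complex.sub_im] at h1
    have h2 := (abs_le.1 h1).1
    simp only
    linarith

theorem measurable (h : Dominates v W φ) : Measurable φ := by
  have h1 : Measurable fun x => (φ x).re := by
    simpa [Pi.sub_def] using h.monotone_re_add.measurable.sub h.monotone.measurable
  have h2 : Measurable fun x => (φ x).im := by
    simpa [Pi.sub_def] using h.monotone_im_add.measurable.sub h.monotone.measurable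
  exact measurable_of_re_im h1 h2

theorem intervalIntegrable (h : Dominates v W φ) (a b : ℝ) :
    IntervalIntegrable φ volume a b := by
  refine (intervalIntegrable_const (c := ‖φ (min a b)‖ + (v (max a b) - v (min a b)))).mono_fun'
    h.measurable.aestronglyMeasurable ?_
  refine (ae_restrict_mem measurableSet_uIoc).mono fun x hx => ?_
  have h1 := h.norm_sub_le _ x hx.1.le
  have h2 := norm_sub_norm_le (φ x) (φ (min a b))
  have h3 := h.monotone hx.2
  linarith

theorem integral_sub_eq (h : Dominates v W φ) (t : ℝ) :
    ∫ x in (0 : ℝ)..1, (v (x + t) - v x) = W * t := by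
  have hi : ∀ a b, IntervalIntegrable v volume a b := fun a b => h.monotone.intervalIntegrable
  have hs : ∀ t a b, IntervalIntegrable (fun x => v (x + t)) volume a b := fun t a b =>
    Monotone.intervalIntegrable fun x y hxy => h.monotone (by linarith)
  rw [intervalIntegral.integral_sub (hs t 0 1) (hi 0 1),
    intervalIntegral.integral_comp_add_right, zero_add]
  have h1 : ∫ x in (0 : ℝ)..t, v (x + 1) = (∫ x in (0 : ℝ)..t, v x) + t * W := by
    simp_rw [h.add_one]
    rw [intervalIntegral.integral_add (hi 0 t) intervalIntegrable_const]
    simp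
  rw [intervalIntegral.integral_comp_add_right, zero_add] at h1
  have h2 := intervalIntegral.integral_add_adjacent_intervals (hi 0 1) (hi 1 (t + 1))
  have h3 := intervalIntegral.integral_add_adjacent_intervals (hi 0 t) (hi t (t + 1))
  rw [add_comm 1 t]
  linarith

/-- The `L¹` modulus of continuity of a periodic function of bounded variation is linear. -/
theorem integral_norm_shift_le (h : Dominates v W φ) (hp : Function.Periodic φ 1) (t : ℝ) :
    ∫ x in (0 : ℝ)..1, ‖φ (x + t) - φ x‖ ≤ W * |t| := by
  have key : ∀ t, 0 ≤ t → ∫ x in (0 : ℝ)..1, ‖φ (x + t) - φ x‖ ≤ W * t := by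
    intro t ht
    rw [← h.integral_sub_eq t]
    have hs : IntervalIntegrable (fun x => v (x + t)) volume 0 1 :=
      Monotone.intervalIntegrable fun x y hxy => h.monotone (by linarith)
    have hs' : IntervalIntegrable (fun x => φ (x + t)) volume 0 1 := by
      simpa using (h.intervalIntegrable (0 + t) (1 + t)).comp_add_right t
    exact intervalIntegral.integral_mono_on zero_le_one
      (hs'.sub (h.intervalIntegrable 0 1)).norm (hs.sub h.monotone.intervalIntegrable)
      fun x _ => h.norm_sub_le _ _ (by linarith)
  rcases le_total 0 t with ht | ht
  · rw [abs_of_nonneg ht]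
    exact key t ht
  · rw [abs_of_nonpos ht]
    refine le_of_eq_of_le ?_ (key (-t) (by linarith))
    have hper : Function.Periodic (fun x => ‖φ (x + -t) - φ x‖) 1 := fun x => by
      simp only [hp x, add_right_comm x 1 (-t), hp (x + -t)]
    have h1 := hper.intervalIntegral_add_eq t 0
    rw [zero_add] at h1
    rw [← h1, add_comm t 1]
    have h2 := intervalIntegral.integral_comp_add_right (a := 0) (b := 1)
      (fun x => ‖φ (x + -t) - φ x‖) t
    rw [zero_add] at h2
    rw [← h2]
    refine intervalIntegral.integral_congr fun x _ => ?_
    simp only [add_neg_cancel_right]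
    exact norm_sub_rev _ _

end Dominates

/-! ### The Denjoy–Koksma inequality -/

/-- Multiplication by `p` permutes the residues modulo `q`. -/
theorem sum_periodic_mul_div {E : Type*} [AddCommMonoid E] {g : ℝ → E}
    (hg : Function.Periodic g 1) {p : ℤ} {q : ℕ} (hq : 0 < q) (hpq : IsCoprime p (q : ℤ))
    (s : ℝ) :
    ∑ j ∈ Finset.range q, g (s + j * (p / q)) = ∑ j ∈ Finset.range q, g (s + j / q) := by
  have hq' : (q : ℤ) ≠ 0 := by positivity
  have hqr : (q : ℝ) ≠ 0 := by positivity
  have hnn : ∀ j : ℕ, (((j * p % q).toNat : ℕ) : ℤ) = j * p % q := fun j =>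
    Int.toNat_of_nonneg (Int.emod_nonneg _ hq')
  have hmaps : ∀ j ∈ Finset.range q, (j * p % q).toNat ∈ Finset.range q := fun j _ => by
    rw [Finset.mem_range]
    zify
    rw [hnn]
    exact Int.emod_lt_of_pos _ (by positivity)
  have hinj : Set.InjOn (fun j : ℕ => (j * p % q).toNat) (Finset.range q) := by
    intro i hi j hj hij
    simp only at hij
    have h1 : (i * p % q : ℤ) = j * p % q := by rw [← hnn i, ← hnn j, hij]
    have h2 : (q : ℤ) ∣ (i - j) * p := by
      rw [sub_mul]
      exact Int.ModEq.dvd (Int.ModEq.symm h1)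
    have h3 : (i : ℤ) ≡ j [ZMOD q] :=
      (Int.modEq_iff_dvd.2 (hpq.symm.dvd_of_dvd_mul_right h2)).symm
    have hi' := Finset.mem_range.1 hi
    have hj' := Finset.mem_range.1 hj
    exact Nat.ModEq.eq_of_lt_of_lt ((Int.natCast_modEq_iff).1 h3) hi' hj'
  refine Finset.sum_nbij (fun j => (j * p % q).toNat) hmaps hinj
    (Finset.surjOn_of_injOn_of_card_le _ hmaps hinj le_rfl) fun j _ => ?_
  have h1 : ((j * p % q).toNat : ℝ) = j * p - (q : ℝ) * ((j * p / q : ℤ) : ℝ) := by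
    have h2 := Int.emod_def (j * p) q
    rw [← hnn] at h2
    exact_mod_cast h2
  have h2 : s + j * (p / q) = s + ((j * p % q).toNat : ℝ) / q + ((j * p / q : ℤ) : ℝ) * 1 := by
    rw [h1]
    field_simp
    ring
  rw [h2]
  exact (hg.int_mul _) _

/-- The `q` arcs of length `1/q` tile the circle and each has one sample point. Replacing `φ (t j)`
by the mean of `φ` over its arc costs at most the `v`-mass of the arc; these masses add up to `W`,
and the means add up to `q ∫ φ = 0`. -/
theorem Dominates.norm_sum_le_of_mem_Icc {v : ℝ → ℝ} {W : ℝ} {φ : ℝ → ℂ} (h : Dominates v W φ)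
    (hp : Function.Periodic φ 1) (hc : ∫ x in (0 : ℝ)..1, φ x = 0) {p : ℤ} {q : ℕ} (hq : 0 < q)
    (hpq : IsCoprime p (q : ℤ)) (s : ℝ) (t : ℕ → ℝ)
    (ht : ∀ j < q, t j ∈ Icc (s + j * (p / q)) (s + j * (p / q) + 1 / q)) :
    ‖∑ j ∈ Finset.range q, φ (t j)‖ ≤ W := by
  have hqr : (0 : ℝ) < q := by positivity
  have hgrid : ∀ j : ℕ, s + (j : ℝ) / q + 1 / q = s + ((j + 1 : ℕ) : ℝ) / q := fun j => by
    push_cast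
    ring
  have hint : ∑ j ∈ Finset.range q, ∫ x in (s + j * (p / q))..(s + j * (p / q) + 1 / q), φ x
      = 0 := by
    have hper : Function.Periodic (fun y => ∫ x in y..(y + 1 / q), φ x) 1 := fun y => by
      simp only
      rw [add_right_comm, ← intervalIntegral.integral_comp_add_right]
      simp_rw [hp _]
    rw [sum_periodic_mul_div hper hq hpq s]
    simp only [hgrid]
    rw [intervalIntegral.sum_integral_adjacent_intervals (a := fun j : ℕ => s + (j : ℝ) / q)
      fun k _ => h.intervalIntegrable _ _]
    rw [div_self hqr.ne', Nat.cast_zero, zero_div, add_zero, hp.intervalIntegral_add_eq s 0,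
      zero_add, hc]
  have hv : ∑ j ∈ Finset.range q, (v (s + j * (p / q) + 1 / q) - v (s + j * (p / q))) = W := by
    have hper : Function.Periodic (fun y => v (y + 1 / q) - v y) 1 := fun y => by
      simp only
      rw [add_right_comm, h.add_one, h.add_one]
      ring
    rw [sum_periodic_mul_div hper hq hpq s]
    simp only [hgrid]
    rw [Finset.sum_range_sub (fun j : ℕ => v (s + (j : ℝ) / q)), div_self hqr.ne', h.add_one]
    simp
  have hterm : ∀ j < q, ‖φ (t j) - (q : ℂ) * ∫ x in (s + j * (p / q))..(s + j * (p / q) + 1 / q),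
      φ x‖ ≤ v (s + j * (p / q) + 1 / q) - v (s + j * (p / q)) := by
    intro j hj
    set a := s + j * (p / q)
    have hab : a ≤ a + 1 / q := by simp
    have h1 : φ (t j) - (q : ℂ) * ∫ x in a..(a + 1 / q), φ x
        = q * ∫ x in a..(a + 1 / q), (φ (t j) - φ x) := by
      rw [intervalIntegral.integral_sub intervalIntegrable_const (h.intervalIntegrable _ _),
        intervalIntegral.integral_const, mul_sub, add_sub_cancel_left, Complex.real_smul]
      push_cast
      rw [← mul_assoc, mul_one_div_cancel (by exact_mod_cast hqr.ne'), one_mul]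
    have h2 : ‖∫ x in a..(a + 1 / q), (φ (t j) - φ x)‖
        ≤ (v (a + 1 / q) - v a) * |a + 1 / q - a| := by
      refine intervalIntegral.norm_integral_le_of_norm_le_const fun x hx => ?_
      rw [uIoc_of_le hab] at hx
      have m1 := h.monotone (ht j hj).1
      have m2 := h.monotone (ht j hj).2
      have m3 := h.monotone hx.1.le
      have m4 := h.monotone hx.2
      rcases le_total x (t j) with hxt | hxt
      · have := h.norm_sub_le _ _ hxt
        linarith
      · have := h.norm_sub_le _ _ hxt
        rw [norm_sub_rev] at this
        linarith
    rw [h1, norm_mul, Complex.norm_natCast]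
    rw [add_sub_cancel_left, abs_of_pos (by positivity)] at h2
    calc _ ≤ (q : ℝ) * ((v (a + 1 / q) - v a) * (1 / q)) := by gcongr
      _ = _ := by field_simp
  have hsum : ∑ j ∈ Finset.range q, φ (t j) = ∑ j ∈ Finset.range q,
      (φ (t j) - (q : ℂ) * ∫ x in (s + j * (p / q))..(s + j * (p / q) + 1 / q), φ x) := by
    rw [Finset.sum_sub_distrib, ← Finset.mul_sum, hint, mul_zero, sub_zero]
  rw [hsum, ← hv]
  exact norm_sum_le_of_le _ fun j hj => hterm j (Finset.mem_range.1 hj)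

/-- The Denjoy–Koksma inequality. -/
theorem Dominates.norm_ergodicSum_le {v : ℝ → ℝ} {W : ℝ} {φ : ℝ → ℂ} (h : Dominates v W φ)
    (hp : Function.Periodic φ 1) (hc : ∫ x in (0 : ℝ)..1, φ x = 0) {p : ℤ} {q : ℕ} (hq : 0 < q)
    (hpq : IsCoprime p (q : ℤ)) {α : ℝ} (hα : |q * α - p| ≤ 1 / q) (x : ℝ) :
    ‖ergodicSum α φ q x‖ ≤ W := by
  have hqr : (0 : ℝ) < q := by positivity
  have hdev : ∀ j < q, |j * (α - p / q)| ≤ 1 / q := by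
    intro j hj
    have h1 : j * (α - p / q) = (j / q) * (q * α - p) := by field_simp
    have h2 : (j : ℝ) / q ≤ 1 := by
      rw [div_le_one hqr]
      exact_mod_cast hj.le
    rw [h1, abs_mul, abs_of_nonneg (by positivity)]
    calc _ ≤ 1 * |q * α - p| := by gcongr
      _ ≤ _ := by rwa [one_mul]
  -- The orbit drifts from the rational grid by at most `1/q`, always to the same side, so the arcs
  -- are laid to the right or to the left of the grid points.
  rcases le_total 0 (α - p / q) with hs | hs
  · refine h.norm_sum_le_of_mem_Icc hp hc hq hpq x _ fun j hj => ?_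
    have h1 := (abs_le.1 (hdev j hj)).2
    have h2 : 0 ≤ j * (α - p / q) := by positivity
    constructor <;> linarith
  · refine h.norm_sum_le_of_mem_Icc hp hc hq hpq (x - 1 / q) _ fun j hj => ?_
    have h1 := (abs_le.1 (hdev j hj)).1
    have h2 : j * (α - p / q) ≤ 0 := mul_nonpos_of_nonneg_of_nonpos (by positivity) hs
    constructor <;> linarith

/-! ### Convergents and their approximation quality -/

/-- The numerators of the convergents of `α`. -/
def numerator (α : ℝ) : ℕ → ℤ
  | 0 => ⌊α⌋
  | 1 => partialQuotient α 1 * ⌊α⌋ + 1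
  | n + 2 => partialQuotient α (n + 2) * numerator α (n + 1) + numerator α n

theorem nums_of_irrational {α : ℝ} (hα : Irrational α) (n : ℕ) :
    (GenContFract.of α).nums n = (numerator α n : ℝ) := by
  induction n using Nat.twoStepInduction with
  | zero => simp [numerator]
  | one => simpa [numerator] using GenContFract.first_num_eq (get?_s_of_irrational hα 0)
  | more n ih0 ih1 =>
    rw [GenContFract.nums_recurrence (get?_s_of_irrational hα (n + 1)) ih0 ih1]
    simp [numerator]

theorem one_le_partialQuotient {α : ℝ} (hα : Irrational α) (n : ℕ) :
    1 ≤ partialQuotient α (n + 1) := by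
  exact_mod_cast GenContFract.of_one_le_get?_partDen (get?_partDens_of_irrational hα n)

theorem denominator_pos {α : ℝ} (hα : Irrational α) (n : ℕ) : 0 < denominator α n := by
  induction n using Nat.twoStepInduction with
  | zero => simp [denominator]
  | one => exact one_le_partialQuotient hα 0
  | more n ih0 ih1 => simp [denominator, ih0]

theorem denominator_le_succ {α : ℝ} (hα : Irrational α) (n : ℕ) :
    denominator α n ≤ denominator α (n + 1) := by
  cases n with
  | zero => exact one_le_partialQuotient hα 0
  | succ n =>
    exact (Nat.le_mul_of_pos_left _ (one_le_partialQuotient hα (n + 1))).trans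
      (Nat.le_add_right _ _)

theorem monotone_denominator {α : ℝ} (hα : Irrational α) : Monotone (denominator α) :=
  monotone_nat_of_le_succ (denominator_le_succ hα)

theorem denominator_succ_le {α : ℝ} (hα : Irrational α) (n : ℕ) :
    denominator α (n + 1) ≤ (partialQuotient α (n + 1) + 1) * denominator α n := by
  cases n with
  | zero => simp [denominator]
  | succ n =>
    have := denominator_le_succ hα n
    simp only [denominator] at this ⊢
    linarith

theorem determinant_eq (α : ℝ) (n : ℕ) :
    numerator α n * denominator α (n + 1) - denominator α n * numerator α (n + 1)
      = (-1) ^ (n + 1) := by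
  induction n with
  | zero =>
    simp only [numerator, denominator]
    push_cast
    ring
  | succ n ih =>
    simp only [numerator, denominator]
    push_cast
    rw [pow_succ, ← ih]
    ring

theorem isCoprime_numerator_denominator (α : ℝ) (n : ℕ) :
    IsCoprime (numerator α n) (denominator α n : ℤ) := by
  have h := determinant_eq α n
  have h1 : ((-1 : ℤ) ^ (n + 1)) * (-1) ^ (n + 1) = 1 := by
    rw [← mul_pow]
    simp
  refine ⟨(-1) ^ (n + 1) * denominator α (n + 1), -((-1) ^ (n + 1) * numerator α (n + 1)), ?_⟩
  linear_combination (-1) ^ (n + 1) * h + h1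

theorem abs_denominator_mul_sub_numerator_le {α : ℝ} (hα : Irrational α) (n : ℕ) :
    |denominator α n * α - numerator α n| ≤ 1 / denominator α n := by
  have hnt : ¬ (GenContFract.of α).TerminatedAt n := by
    intro h
    obtain ⟨q, hq⟩ := (GenContFract.terminates_iff_rat α).1 ⟨n, h⟩
    exact hα ⟨q, hq.symm⟩
  have h := GenContFract.abs_sub_convs_le hnt
  rw [GenContFract.conv_eq_num_div_den, nums_of_irrational hα, dens_of_irrational hα,
    dens_of_irrational hα] at h
  have h0 : (0 : ℝ) < denominator α n := by exact_mod_cast denominator_pos hα n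
  have h1 : (denominator α n : ℝ) ≤ denominator α (n + 1) := by
    exact_mod_cast denominator_le_succ hα n
  have h2 : (denominator α n * α - numerator α n : ℝ)
      = denominator α n * (α - numerator α n / denominator α n) := by field_simp
  rw [h2, abs_mul, abs_of_pos h0]
  calc _ ≤ (denominator α n : ℝ) * (1 / (denominator α n * denominator α (n + 1))) := by gcongr
    _ = 1 / denominator α (n + 1) := by field_simp
    _ ≤ _ := by gcongr

/-! ### Bounds for ergodic sums -/

theorem ergodicSum_add (α : ℝ) (φ : ℝ → ℂ) (M N : ℕ) (x : ℝ) :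
    ergodicSum α φ (M + N) x = ergodicSum α φ M x + ergodicSum α φ N (x + M * α) := by
  simp only [ergodicSum, Finset.sum_range_add]
  congr 1
  refine Finset.sum_congr rfl fun j _ => ?_
  push_cast
  ring_nf

theorem norm_ergodicSum_mul_le {α : ℝ} {φ : ℝ → ℂ} {q : ℕ} {W : ℝ}
    (h : ∀ x, ‖ergodicSum α φ q x‖ ≤ W) (b : ℕ) (x : ℝ) :
    ‖ergodicSum α φ (b * q) x‖ ≤ W * b := by
  induction b with
  | zero => simp [ergodicSum]
  | succ b ih =>
    rw [add_mul, one_mul, ergodicSum_add]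
    refine (norm_add_le _ _).trans ((add_le_add ih (h _)).trans_eq ?_)
    push_cast
    ring

theorem ergodicSum_shift_sub (α : ℝ) (φ : ℝ → ℂ) (N : ℕ) (x : ℝ) :
    ergodicSum α φ N (x + α) - ergodicSum α φ N x = φ (x + N * α) - φ x := by
  have h := Finset.sum_range_sub (fun j : ℕ => φ (x + j * α)) N
  simp only [Nat.cast_zero, zero_mul, add_zero] at h
  rw [← h, Finset.sum_sub_distrib]
  simp only [ergodicSum]
  congr 1
  refine Finset.sum_congr rfl fun j _ => ?_
  push_cast
  ring_nf

theorem periodic_ergodicSum {φ : ℝ → ℂ} (hp : Function.Periodic φ 1) (α : ℝ) (N : ℕ) :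
    Function.Periodic (ergodicSum α φ N) 1 := fun x => by
  simp only [ergodicSum]
  refine Finset.sum_congr rfl fun j _ => ?_
  rw [add_right_comm, hp]

theorem measurable_ergodicSum {φ : ℝ → ℂ} (hm : Measurable φ) (α : ℝ) (N : ℕ) :
    Measurable (ergodicSum α φ N) := by
  unfold ergodicSum
  fun_prop

theorem IsCenteredBV.intervalIntegral_eq_zero {φ : ℝ → ℂ} (h : IsCenteredBV φ) :
    ∫ x in (0 : ℝ)..1, φ x = 0 := by
  rw [intervalIntegral.integral_of_le zero_le_one, ← integral_Ico_eq_integral_Ioc, h.centered]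

theorem IsCenteredBV.measurable {φ : ℝ → ℂ} (h : IsCenteredBV φ) : Measurable φ := by
  obtain ⟨v, hv⟩ := exists_dominates h.periodic h.boundedVariation
  exact hv.measurable

theorem IsCenteredBV.norm_ergodicSum_denominator_le {φ : ℝ → ℂ} (h : IsCenteredBV φ) {α : ℝ}
    (hα : Irrational α) (n : ℕ) (x : ℝ) :
    ‖ergodicSum α φ (denominator α n) x‖ ≤ 2 * variation φ := by
  obtain ⟨v, hv⟩ := exists_dominates h.periodic h.boundedVariation
  exact hv.norm_ergodicSum_le h.periodic h.intervalIntegral_eq_zero (denominator_pos hα n)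
    (isCoprime_numerator_denominator α n) (abs_denominator_mul_sub_numerator_le hα n) x

/-- Ergodic sums up to time `q_n` are controlled by the sum of the first `n` partial quotients. -/
theorem IsCenteredBV.norm_ergodicSum_le {φ : ℝ → ℂ} (h : IsCenteredBV φ) {α : ℝ}
    (hα : Irrational α) (n : ℕ) : ∀ k < denominator α n, ∀ x,
    ‖ergodicSum α φ k x‖
      ≤ 2 * variation φ * ∑ i ∈ Finset.range n, (partialQuotient α (i + 1) : ℝ) := by
  induction n with
  | zero =>
    intro k hk x
    obtain rfl : k = 0 := by simpa [denominator] using hk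
    simp [ergodicSum]
  | succ n ih =>
    intro k hk x
    have hq := denominator_pos hα n
    -- Ostrowski-type division: `k` splits into at most `a_{n+1}` blocks of length `q_n`, each
    -- costing `2 V`, and a remainder below `q_n` left to the induction.
    have hc : k / denominator α n ≤ partialQuotient α (n + 1) :=
      Nat.lt_succ_iff.1 (Nat.div_lt_of_lt_mul
        ((hk.trans_le (denominator_succ_le hα n)).trans_eq (mul_comm _ _)))
    have hk' : k = k / denominator α n * denominator α n + k % denominator α n :=
      (Nat.div_add_mod' _ _).symm
    have h1 := norm_ergodicSum_mul_le (h.norm_ergodicSum_denominator_le hα n)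
      (k / denominator α n) x
    have h2 := ih _ (Nat.mod_lt k hq) (x + ((k / denominator α n * denominator α n : ℕ) : ℝ) * α)
    have h3 : ((k / denominator α n : ℕ) : ℝ) ≤ partialQuotient α (n + 1) := by exact_mod_cast hc
    have h4 := mul_le_mul_of_nonneg_left h3
      (mul_nonneg zero_le_two (variation_nonneg φ))
    rw [hk', ergodicSum_add, Finset.sum_range_succ, mul_add]
    exact (norm_add_le _ _).trans (by linarith)

/-! ### Almost invariant functions -/

/-- `F` is a `1`-periodic function bounded by `B` which moves by at most `B * δ` in `L¹` under the
rotation by `α`. -/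
structure IsAlmostInvariant (α : ℝ) (F : ℝ → ℂ) (B δ : ℝ) : Prop where
  measurable : Measurable F
  periodic : Function.Periodic F 1
  norm_le : ∀ x, ‖F x‖ ≤ B
  integral_norm_shift_le : ∫ x in (0 : ℝ)..1, ‖F (x + α) - F x‖ ≤ B * δ

theorem intervalIntegrable_of_norm_le {F : ℝ → ℂ} (hm : Measurable F) {B : ℝ}
    (hB : ∀ x, ‖F x‖ ≤ B) (a b : ℝ) : IntervalIntegrable F volume a b :=
  (intervalIntegrable_const (c := B)).mono_fun' hm.aestronglyMeasurable
    (Filter.Eventually.of_forall hB)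

theorem IsAlmostInvariant.intervalIntegrable_shift_sub {α : ℝ} {F : ℝ → ℂ} {B δ : ℝ}
    (h : IsAlmostInvariant α F B δ) :
    IntervalIntegrable (fun x => F (x + α) - F x) volume 0 1 := by
  have hm := h.measurable
  exact intervalIntegrable_of_norm_le (by fun_prop)
    (fun x => (norm_sub_le _ _).trans (add_le_add (h.norm_le _) (h.norm_le _))) 0 1

/-- Leibniz rule: since the defect is measured relative to the bound, bounds multiply and defects
add. -/
theorem IsAlmostInvariant.mul {α : ℝ} {F G : ℝ → ℂ} {B δ B' δ' : ℝ}
    (hF : IsAlmostInvariant α F B δ) (hG : IsAlmostInvariant α G B' δ') :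
    IsAlmostInvariant α (fun x => F x * G x) (B * B') (δ + δ') where
  measurable := hF.measurable.mul hG.measurable
  periodic := hF.periodic.mul hG.periodic
  norm_le x := by
    rw [norm_mul]
    exact mul_le_mul (hF.norm_le x) (hG.norm_le x) (norm_nonneg _)
      ((norm_nonneg _).trans (hF.norm_le x))
  integral_norm_shift_le := by
    have hB : 0 ≤ B := (norm_nonneg _).trans (hF.norm_le 0)
    have hB' : 0 ≤ B' := (norm_nonneg _).trans (hG.norm_le 0)
    have iF := hF.intervalIntegrable_shift_sub.norm
    have iG := hG.intervalIntegrable_shift_sub.norm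
    have mF := hF.measurable
    have mG := hG.measurable
    have iFG : IntervalIntegrable (fun x => F (x + α) * G (x + α) - F x * G x) volume 0 1 := by
      refine intervalIntegrable_of_norm_le (B := B * B' + B * B') (by fun_prop) (fun x => ?_) 0 1
      refine (norm_sub_le _ _).trans (add_le_add ?_ ?_) <;> rw [norm_mul] <;>
        exact mul_le_mul (hF.norm_le _) (hG.norm_le _) (norm_nonneg _) hB
    calc ∫ x in (0 : ℝ)..1, ‖F (x + α) * G (x + α) - F x * G x‖
        ≤ ∫ x in (0 : ℝ)..1, (B' * ‖F (x + α) - F x‖ + B * ‖G (x + α) - G x‖) := by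
          refine intervalIntegral.integral_mono_on zero_le_one iFG.norm
            ((iF.const_mul _).add (iG.const_mul _)) fun x _ => ?_
          have h1 : F (x + α) * G (x + α) - F x * G x
              = G (x + α) * (F (x + α) - F x) + F x * (G (x + α) - G x) := by ring
          rw [h1]
          refine (norm_add_le _ _).trans ?_
          rw [norm_mul, norm_mul]
          gcongr
          · exact hG.norm_le _
          · exact hF.norm_le _
      _ = B' * (∫ x in (0 : ℝ)..1, ‖F (x + α) - F x‖)
          + B * ∫ x in (0 : ℝ)..1, ‖G (x + α) - G x‖ := by
          rw [intervalIntegral.integral_add (iF.const_mul _) (iG.const_mul _),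
            intervalIntegral.integral_const_mul, intervalIntegral.integral_const_mul]
      _ ≤ B' * (B * δ) + B * (B' * δ') := by
          gcongr
          · exact hF.integral_norm_shift_le
          · exact hG.integral_norm_shift_le
      _ = B * B' * (δ + δ') := by ring

/-- The shift difference telescopes to `φ (x + b q_n α) - φ x`. Modulo `1` the step is `b (q_n α -
p_n)`, of size at most `b / q_n`, and the linear `L¹` modulus applies. -/
theorem IsCenteredBV.isAlmostInvariant_ergodicSum {φ : ℝ → ℂ} (h : IsCenteredBV φ) {α : ℝ}
    (hα : Irrational α) (b n : ℕ) :
    IsAlmostInvariant α (ergodicSum α φ (b * denominator α n)) (2 * variation φ * b)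
      (1 / denominator α n) where
  measurable := measurable_ergodicSum h.measurable α _
  periodic := periodic_ergodicSum h.periodic α _
  norm_le := norm_ergodicSum_mul_le (h.norm_ergodicSum_denominator_le hα n) b
  integral_norm_shift_le := by
    obtain ⟨v, hv⟩ := exists_dominates h.periodic h.boundedVariation
    have h1 : ∀ x, φ (x + (b * denominator α n : ℕ) * α)
        = φ (x + b * (denominator α n * α - numerator α n)) := fun x => by
      have h2 : x + (b * denominator α n : ℕ) * α
          = x + b * (denominator α n * α - numerator α n) + ((b * numerator α n : ℤ) : ℝ) * 1 := by
        push_cast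
        ring
      rw [h2]
      exact h.periodic.int_mul _ _
    simp only [ergodicSum_shift_sub, h1]
    refine (hv.integral_norm_shift_le h.periodic _).trans ?_
    rw [abs_mul, Nat.abs_cast, ← mul_assoc]
    have := variation_nonneg φ
    gcongr
    exact abs_denominator_mul_sub_numerator_le hα n

/-! ### The coboundary argument -/

/-- Every function is a coboundary up to its ergodic average. -/
theorem eq_sub_shift_add_ergodicSum (α : ℝ) (ψ : ℝ → ℂ) {N : ℕ} (hN : 0 < N) (x : ℝ) :
    ψ x = (∑ k ∈ Finset.range N, ergodicSum α ψ k x) / N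
      - (∑ k ∈ Finset.range N, ergodicSum α ψ k (x + α)) / N + ergodicSum α ψ N x / N := by
  have h : ∑ k ∈ Finset.range N, (ergodicSum α ψ k (x + α) - ergodicSum α ψ k x)
      = ergodicSum α ψ N x - N * ψ x := by
    simp only [ergodicSum_shift_sub, Finset.sum_sub_distrib]
    simp [ergodicSum]
  rw [Finset.sum_sub_distrib] at h
  have hN' : (N : ℂ) ≠ 0 := by exact_mod_cast hN.ne'
  field_simp
  linear_combination h

theorem IsAlmostInvariant.norm_integral_mul_le {α : ℝ} {F : ℝ → ℂ} {B δ : ℝ}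
    (hF : IsAlmostInvariant α F B δ) {ψ : ℝ → ℂ} (hψ : Measurable ψ)
    (hψp : Function.Periodic ψ 1) {N : ℕ} (hN : 0 < N) {M W : ℝ}
    (hM : ∀ k < N, ∀ x, ‖ergodicSum α ψ k x‖ ≤ M) (hW : ∀ x, ‖ergodicSum α ψ N x‖ ≤ W) :
    ‖∫ x in (0 : ℝ)..1, ψ x * F x‖ ≤ M * (B * δ) + W * B / N := by
  have hNr : (0 : ℝ) < N := by exact_mod_cast hN
  have hB : 0 ≤ B := (norm_nonneg _).trans (hF.norm_le 0)
  have hM0 : 0 ≤ M := (norm_nonneg _).trans (hM 0 hN 0)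
  have hW0 : 0 ≤ W := (norm_nonneg _).trans (hW 0)
  set u : ℝ → ℂ := fun x => (∑ k ∈ Finset.range N, ergodicSum α ψ k x) / N with hu
  have mF := hF.measurable
  have mψ : ∀ k, Measurable (ergodicSum α ψ k) := measurable_ergodicSum hψ α
  have mu : Measurable u := by fun_prop
  have uB : ∀ x, ‖u x‖ ≤ M := fun x => by
    rw [hu]
    simp only [norm_div, Complex.norm_natCast]
    rw [div_le_iff₀ hNr]
    refine (norm_sum_le_of_le _ fun k hk => hM k (Finset.mem_range.1 hk) x).trans_eq ?_
    simp [mul_comm]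
  have up : Function.Periodic u 1 := fun x => by
    simp only [hu, periodic_ergodicSum hψp α _ x]
  have bnd : ∀ {G H : ℝ → ℂ} {a b : ℝ}, 0 ≤ a → (∀ x, ‖G x‖ ≤ a) → (∀ x, ‖H x‖ ≤ b) →
      ∀ x, ‖G x * H x‖ ≤ a * b := fun ha h1 h2 x => by
    rw [norm_mul]
    exact mul_le_mul (h1 x) (h2 x) (norm_nonneg _) ha
  have iuF : IntervalIntegrable (fun x => u x * F x) volume 0 1 :=
    intervalIntegrable_of_norm_le (by fun_prop) (bnd hM0 uB hF.norm_le) 0 1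
  have iuF' : IntervalIntegrable (fun x => u (x + α) * F (x + α)) volume 0 1 :=
    intervalIntegrable_of_norm_le (by fun_prop)
      (bnd hM0 (fun x => uB (x + α)) fun x => hF.norm_le (x + α)) 0 1
  have iud : IntervalIntegrable (fun x => u (x + α) * (F (x + α) - F x)) volume 0 1 :=
    intervalIntegrable_of_norm_le (by fun_prop)
      (bnd hM0 (fun x => uB (x + α)) fun x => (norm_sub_le _ _).trans
        (add_le_add (hF.norm_le _) (hF.norm_le _))) 0 1
  have iψF : IntervalIntegrable (fun x => ergodicSum α ψ N x * F x) volume 0 1 :=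
    intervalIntegrable_of_norm_le (by fun_prop) (bnd hW0 hW hF.norm_le) 0 1
  -- Translation invariance moves the coboundary from `ψ` onto `F`.
  have hshift : ∫ x in (0 : ℝ)..1, u (x + α) * F (x + α) = ∫ x in (0 : ℝ)..1, u x * F x := by
    rw [intervalIntegral.integral_comp_add_right (fun x => u x * F x), zero_add, add_comm 1 α]
    simpa using (up.mul hF.periodic).intervalIntegral_add_eq α 0
  have hdecomp : ∫ x in (0 : ℝ)..1, ψ x * F x
      = (∫ x in (0 : ℝ)..1, u (x + α) * (F (x + α) - F x))
        + (∫ x in (0 : ℝ)..1, ergodicSum α ψ N x * F x) / N := by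
    have h1 : ∀ x, ψ x * F x = (u x * F x - u (x + α) * F (x + α))
        + (u (x + α) * (F (x + α) - F x) + ergodicSum α ψ N x * F x / N) := fun x => by
      conv_lhs => rw [eq_sub_shift_add_ergodicSum α ψ hN x]
      simp only [hu]
      ring
    simp_rw [h1]
    rw [intervalIntegral.integral_add (iuF.sub iuF') (iud.add (iψF.div_const _)),
      intervalIntegral.integral_sub iuF iuF', hshift, sub_self, zero_add,
      intervalIntegral.integral_add iud (iψF.div_const _), intervalIntegral.integral_div]
  rw [hdecomp]
  refine (norm_add_le _ _).trans (add_le_add ?_ ?_)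
  · calc _ ≤ ∫ x in (0 : ℝ)..1, ‖u (x + α) * (F (x + α) - F x)‖ :=
          intervalIntegral.norm_integral_le_integral_norm zero_le_one
      _ ≤ ∫ x in (0 : ℝ)..1, M * ‖F (x + α) - F x‖ := by
          refine intervalIntegral.integral_mono_on zero_le_one iud.norm
            (hF.intervalIntegrable_shift_sub.norm.const_mul _) fun x _ => ?_
          rw [norm_mul]
          gcongr
          exact uB _
      _ ≤ M * (B * δ) := by
          rw [intervalIntegral.integral_const_mul]
          gcongr
          exact hF.integral_norm_shift_le
  · rw [norm_div, Complex.norm_natCast]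
    gcongr
    have := intervalIntegral.norm_integral_le_of_norm_le_const (a := 0) (b := 1)
      (f := fun x => ergodicSum α ψ N x * F x) fun x _ => bnd hW0 hW hF.norm_le x
    simpa using this

/-! ### Polynomial growth of the partial quotients and conclusion -/

theorem sum_partialQuotient_le {α A p : ℝ} (hA : 0 ≤ A) (hp : 0 ≤ p)
    (ha : ∀ n : ℕ, 1 ≤ n → (partialQuotient α n : ℝ) ≤ A * (n : ℝ) ^ p) {n : ℕ} (hn : 1 ≤ n) :
    ∑ i ∈ Finset.range n, (partialQuotient α (i + 1) : ℝ) ≤ A * (n : ℝ) ^ (p + 1) := by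
  have hn' : (0 : ℝ) < n := by exact_mod_cast hn
  have h : ∀ i ∈ Finset.range n, (partialQuotient α (i + 1) : ℝ) ≤ A * (n : ℝ) ^ p :=
    fun i hi => (ha (i + 1) (by simp)).trans (by
      gcongr
      exact Finset.mem_range.1 hi)
  refine (Finset.sum_le_sum h).trans_eq ?_
  rw [Finset.sum_const, Finset.card_range, nsmul_eq_mul, Real.rpow_add hn', Real.rpow_one]
  ring

/-- The coboundary argument at time `N = q_n`, with `n` the smallest index involved. In the
application `K` is the number of ergodic sums in `F` and `k` is the largest index. -/
theorem IsAlmostInvariant.norm_setIntegral_mul_le {α : ℝ} (hα : Irrational α) {A p : ℝ}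
    (hA : 1 ≤ A) (hp : 0 ≤ p)
    (ha : ∀ n : ℕ, 1 ≤ n → (partialQuotient α n : ℝ) ≤ A * (n : ℝ) ^ p)
    {ψ : ℝ → ℂ} (hψ : IsCenteredBV ψ) {n k : ℕ} (hn : 1 ≤ n) (hnk : n ≤ k)
    {F : ℝ → ℂ} {B δ K : ℝ} (hF : IsAlmostInvariant α F B δ) (hδ : δ ≤ K / denominator α n) :
    ‖∫ x in Ico (0 : ℝ) 1, ψ x * F x‖
      ≤ 2 * A * (K + 1) * variation ψ * B * ((k : ℝ) ^ (p + 1) / denominator α n) := by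
  rw [integral_Ico_eq_integral_Ioc, ← intervalIntegral.integral_of_le zero_le_one]
  have hq : (0 : ℝ) < denominator α n := by exact_mod_cast denominator_pos hα n
  have hB : 0 ≤ B := (norm_nonneg _).trans (hF.norm_le 0)
  have hV := variation_nonneg ψ
  have hk1 : (1 : ℝ) ≤ k := by exact_mod_cast hn.trans hnk
  -- Lets the averaged term, which carries no power of `k`, be absorbed into the same form as the
  -- coboundary term.
  have hone : 1 ≤ A * (k : ℝ) ^ (p + 1) :=
    one_le_mul_of_one_le_of_one_le hA (Real.one_le_rpow hk1 (by linarith))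
  have hS : 2 * variation ψ * ∑ i ∈ Finset.range n, (partialQuotient α (i + 1) : ℝ)
      ≤ 2 * variation ψ * (A * (k : ℝ) ^ (p + 1)) := by
    have := sum_partialQuotient_le (zero_le_one.trans hA) hp ha hn
    gcongr
    exact this.trans (by gcongr)
  refine (hF.norm_integral_mul_le hψ.measurable hψ.periodic (denominator_pos hα n)
    (fun i hi x => (hψ.norm_ergodicSum_le hα n i hi x).trans hS)
    (hψ.norm_ergodicSum_denominator_le hα n)).trans ?_
  calc _ ≤ 2 * variation ψ * (A * (k : ℝ) ^ (p + 1)) * (B * (K / denominator α n))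
        + 2 * variation ψ * B * (A * (k : ℝ) ^ (p + 1)) / denominator α n := by
        refine add_le_add (by gcongr) (div_le_div_of_nonneg_right ?_ hq.le)
        exact le_mul_of_one_le_right (by positivity) hone
    _ = _ := by ring

end CircleRotation

end

theorem mainTheorem3 (A p : ℝ) (hA : 1 ≤ A) (hp : 0 ≤ p) :
    ∃ C θ₁ θ₂ θ₃ : ℝ,
      ∀ α : ℝ, Irrational α → α ∈ Set.Ico (0 : ℝ) 1 →
      (∀ n : ℕ, 1 ≤ n → (CircleRotation.partialQuotient α n : ℝ) ≤ A * (n : ℝ) ^ p) →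
      ∀ ψ φ : ℝ → ℂ, CircleRotation.IsCenteredBV ψ → CircleRotation.IsCenteredBV φ →
      ∀ b : ℕ → ℕ, ∀ n m l : ℕ, 1 ≤ n → n ≤ m → m ≤ l →
        ‖∫ x in Set.Ico (0 : ℝ) 1, ψ x
            * CircleRotation.ergodicSum α φ (b n * CircleRotation.denominator α n) x‖
          ≤ C * CircleRotation.variation ψ * CircleRotation.variation φ
            * ((n : ℝ) ^ θ₁ / (CircleRotation.denominator α n : ℝ)) * (b n : ℝ) ∧
        ‖∫ x in Set.Ico (0 : ℝ) 1, ψ x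
            * CircleRotation.ergodicSum α φ (b n * CircleRotation.denominator α n) x
            * CircleRotation.ergodicSum α φ (b m * CircleRotation.denominator α m) x‖
          ≤ C * CircleRotation.variation ψ * CircleRotation.variation φ ^ 2
            * ((m : ℝ) ^ θ₂ / (CircleRotation.denominator α n : ℝ)) * (b n : ℝ) * (b m : ℝ) ∧
        ‖∫ x in Set.Ico (0 : ℝ) 1, ψ x
            * CircleRotation.ergodicSum α φ (b n * CircleRotation.denominator α n) x
            * CircleRotation.ergodicSum α φ (b m * CircleRotation.denominator α m) x
            * CircleRotation.ergodicSum α φ (b l * CircleRotation.denominator α l) x‖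
          ≤ C * CircleRotation.variation ψ * CircleRotation.variation φ ^ 3
            * ((l : ℝ) ^ θ₃ / (CircleRotation.denominator α n : ℝ))
            * (b n : ℝ) * (b m : ℝ) * (b l : ℝ) := by
  -- With `K` factors the constant is `2 A (K + 1) 2^K`, namely `8 A`, `24 A`, `64 A`. The exponent
  -- `p + 1` comes from summing `n` partial quotients of size at most `A n^p`.
  refine ⟨64 * A, p + 1, p + 1, p + 1, ?_⟩
  intro α hα _ ha ψ φ hψ hφ b n m l hn hnm hml
  have hVψ := CircleRotation.variation_nonneg ψ
  have hVφ := CircleRotation.variation_nonneg φ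
  have hq : (0 : ℝ) < CircleRotation.denominator α n := by
    exact_mod_cast CircleRotation.denominator_pos hα n
  have hinv : ∀ k, n ≤ k →
      1 / (CircleRotation.denominator α k : ℝ) ≤ 1 / CircleRotation.denominator α n := by
    intro k hk
    have : (CircleRotation.denominator α n : ℝ) ≤ CircleRotation.denominator α k := by
      exact_mod_cast CircleRotation.monotone_denominator hα hk
    gcongr
  have hI := fun k => hφ.isAlmostInvariant_ergodicSum hα (b k) k
  have hA0 : 0 ≤ A := zero_le_one.trans hA
  simp only [mul_assoc (ψ _)]
  refine ⟨?_, ?_, ?_⟩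
  · refine ((hI n).norm_setIntegral_mul_le hα hA hp ha hψ hn le_rfl (K := 1) le_rfl).trans ?_
    have h0 : 0 ≤ A * CircleRotation.variation ψ * CircleRotation.variation φ
        * ((n : ℝ) ^ (p + 1) / CircleRotation.denominator α n) * b n := by positivity
    linarith
  · refine (((hI n).mul (hI m)).norm_setIntegral_mul_le hα hA hp ha hψ hn hnm (K := 2) ?_).trans ?_
    · linarith [hinv m hnm, add_div (1 : ℝ) 1 (CircleRotation.denominator α n)]
    have h0 : 0 ≤ A * CircleRotation.variation ψ * CircleRotation.variation φ ^ 2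
        * ((m : ℝ) ^ (p + 1) / CircleRotation.denominator α n) * b n * b m := by positivity
    linarith
  · refine ((((hI n).mul (hI m)).mul (hI l)).norm_setIntegral_mul_le hα hA hp ha hψ hn
      (hnm.trans hml) (K := 3) ?_).trans ?_
    · have h3 : (3 : ℝ) / CircleRotation.denominator α n
          = 3 * (1 / CircleRotation.denominator α n) := by ring
      linarith [hinv m hnm, hinv l (hnm.trans hml)]
    exact le_of_eq (by ring)
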